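/- Let $(X_n)_{n\ge 1}$ be an i.i.d. sequence of random variables with law $\nu$, defined on a probability space $(\Omega,\mathcal A,P)$ and taking values in an arbitrary measurable space $(U,\mathcal U)$. Let $\lambda$ be Lebesgue measure on $[0,1]$ and, for $n\ge 1$, let $\lambda_n=\frac1n\sum_{i=1}^n\delta_{i/n}$. Let $\mathcal Q$ be the class of all $\mathcal B([0,1])\otimes\mathcal U$-measurable functions $q:[0,1]\times U\to\mathbb R$ such that (a) there is a function $g_q\in L_2(\nu)$ with $|q(s,x)|\le g_q(x)$ for all $(s,x)\in[0,1]\times U$; (b) for every $x\in U$, the function $s\mapsto q(s,x)$ on $[0,1]$ is continuous at $\lambda$-almost every point. For $q\in\mathcal Q$ and $n\ge1$ put $$\mathbb P_n(q)=\frac1n\sum_{i=1}^n q(i/n,X_i),\qquad Z_n(q)=\sqrt n\,\bigl(\mathbb P_n(q)-(\lambda_n\otimes\nu)(q)\bigr),$$ and write $\nu(q)(s)=\int_U q(s,x)\,\nu(dx)$. Then there exists a centered Gaussian process $\{Z(q):q\in\mathcal Q\}$ with covariance $$\operatorname{Cov}(Z(q_1),Z(q_2))=\int_{[0,1]}\bigl[\nu(q_1q_2)(s)-\nu(q_1)(s)\,\nu(q_2)(s)\bigr]\,\lambda(ds),\qquad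 q_1,q_2\in\mathcal Q,$$ and for every such process $Z$, the finite-dimensional laws of $Z_n$ converge to those of $Z$: for every $K$ and all $q_1,\dots,q_K\in\mathcal Q$, the random vectors $(Z_n(q_1),\dots,Z_n(q_K))$ converge in law to $(Z(q_1),\dots,Z(q_K))$ as $n\to\infty$. -/

import Mathlib

open MeasureTheory ProbabilityTheory Filter
open scoped unitInterval ENNReal

noncomputable section

/-- The grid point `(i + 1) / n` of `[0, 1]`, for `i ∈ {0, …, n - 1}`. -/
def gridPoint (n : ℕ) (i : Fin n) : I :=
  ⟨((i : ℕ) + 1 : ℝ) / n, by positivity, by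
    have h : ((i : ℕ) + 1 : ℝ) ≤ n := by exact_mod_cast i.isLt
    exact div_le_one_of_le₀ h (Nat.cast_nonneg n)⟩

/-- The uniform discrete measure `λ_n = n⁻¹ ∑_{i=1}^n δ_{i/n}` on `[0, 1]`. -/
def discreteUniform (n : ℕ) : Measure I :=
  (n : ℝ≥0∞)⁻¹ • ∑ i : Fin n, Measure.dirac (gridPoint n i)

/-- The class `𝒬` of jointly measurable functions `q` on `[0, 1] × U`, dominated by a
square-integrable function of `x` alone, and such that every section `s ↦ q (s, x)` is continuous
at Lebesgue-almost every point of `[0, 1]`. -/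
def classQ {U : Type*} [MeasurableSpace U] (ν : Measure U) : Set (I × U → ℝ) :=
  {q | Measurable q ∧
    (∃ g : U → ℝ, MemLp g 2 ν ∧ ∀ (s : I) (x : U), |q (s, x)| ≤ g x) ∧
    ∀ x : U, ∀ᵐ s : I, ContinuousAt (fun t : I => q (t, x)) s}

/-- The sequential empirical measure evaluated at `q`: `n⁻¹ ∑_{i=1}^n q (i/n, X_i)`.
The sample `X_1, X_2, …` is numbered from `0` on, that is `X i` stands for `X_{i+1}`. -/
def seqEmpirical {Ω U : Type*} (X : ℕ → Ω → U) (n : ℕ) (q : I × U → ℝ) (ω : Ω) : ℝ :=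
  (n : ℝ)⁻¹ * ∑ i : Fin n, q (gridPoint n i, X i ω)

/-- `Z_n(q) = √n (ℙ_n(q) - (λ_n ⊗ ν)(q))`. -/
def seqEmpiricalProcess {Ω U : Type*} [MeasurableSpace U] (ν : Measure U) (X : ℕ → Ω → U)
    (n : ℕ) (q : I × U → ℝ) (ω : Ω) : ℝ :=
  √(n : ℝ) * (seqEmpirical X n q ω - ∫ p, q p ∂((discreteUniform n).prod ν))

/-- The limiting covariance
`∫_{[0,1]} (ν(q₁ q₂)(s) - ν(q₁)(s) ν(q₂)(s)) ds`, where `ν(q)(s) = ∫ q (s, x) ν(dx)`. -/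
def kieferCov {U : Type*} [MeasurableSpace U] (ν : Measure U) (q₁ q₂ : I × U → ℝ) : ℝ :=
  ∫ s : I, ((∫ x, q₁ (s, x) * q₂ (s, x) ∂ν) - (∫ x, q₁ (s, x) ∂ν) * ∫ x, q₂ (s, x) ∂ν)

/-- `Z` is a centered Gaussian process indexed by `𝒬` with covariance `kieferCov ν`. -/
structure IsKieferProcess {U Ω : Type*} [MeasurableSpace U] [MeasurableSpace Ω] (ν : Measure U)
    (Z : classQ ν → Ω → ℝ) (P : Measure Ω) : Prop where
  isGaussian : IsGaussianProcess Z P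
  centered : ∀ q, ∫ ω, Z q ω ∂P = 0
  cov_eq : ∀ q₁ q₂ : classQ ν, covariance (Z q₁) (Z q₂) P = kieferCov ν q₁ q₂

end

/-! `Z_n(q)` equals `n^{-1/2} ∑ f_i(X_i)` with `f_i = q(i/n, ·) - ν(q)(i/n)`: a normalized sum of
independent centered variables under one square-integrable envelope. As `𝒬` is a vector space and `q
↦ Z_n(q)` is linear, the Cramér–Wold device (`charFun_map_toLp`, `seqEmpiricalProcess_sum_smul`)
reduces convergence of vectors to that of the characteristic function at `1` for a single `q`.

For one `q` this is a Lindeberg argument (`tendsto_charFun_map_sum_triangular`): each factor is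
compared with a Gaussian one, and the envelope makes the error uniform in `i`. The average variance
is a Riemann sum in `i/n`, which converges to `kieferCov ν q q` by
`tendsto_average_integral_sq_centeredSection`.

For existence, `kieferCov` is the inner product in `L²(λ ⊗ ν)` of the centered functions `q - ν(q)`
(`inner_centeredLp`). Composing `q ↦ q - ν(q)` with an isometry of this space into a space of
Gaussian variables (`exists_isonormal`) gives the process. -/

/-! ### The class `𝒬` and its centered functions. -/

section ClassQ

variable {U : Type*} [MeasurableSpace U] {ν : Measure U}

/-- `classQ ν` as a linear subspace of the functions on `[0, 1] × U`. -/
def classQSubmodule (ν : Measure U) : Submodule ℝ (I × U → ℝ) where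
  carrier := classQ ν
  zero_mem' := ⟨measurable_const, ⟨0, MemLp.zero, by simp⟩, fun x => ae_of_all _ fun s => by
    simpa using continuousAt_const⟩
  add_mem' := by
    rintro q₁ q₂ ⟨hm₁, ⟨g₁, hg₁, hq₁⟩, hc₁⟩ ⟨hm₂, ⟨g₂, hg₂, hq₂⟩, hc₂⟩
    refine ⟨hm₁.add hm₂, ⟨g₁ + g₂, hg₁.add hg₂, fun s x => ?_⟩, fun x => ?_⟩
    · exact (abs_add_le _ _).trans (add_le_add (hq₁ s x) (hq₂ s x))
    · filter_upwards [hc₁ x, hc₂ x] with s h₁ h₂ using h₁.add h₂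
  smul_mem' := by
    rintro c q ⟨hm, ⟨g, hg, hq⟩, hc⟩
    refine ⟨hm.const_smul c, ⟨|c| • g, hg.const_smul _, fun s x => ?_⟩, fun x => ?_⟩
    · simpa [abs_mul] using mul_le_mul_of_nonneg_left (hq s x) (abs_nonneg c)
    · filter_upwards [hc x] with s h using h.const_smul c

lemma measurable_section_of_mem_classQ {q : I × U → ℝ} (hq : q ∈ classQ ν) (s : I) :
    Measurable fun x => q (s, x) :=
  hq.1.comp measurable_prodMk_left

lemma memLp_section_of_mem_classQ {q : I × U → ℝ} (hq : q ∈ classQ ν) (s : I) :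
    MemLp (fun x => q (s, x)) 2 ν := by
  obtain ⟨g, hg, hqg⟩ := hq.2.1
  exact hg.mono' (measurable_section_of_mem_classQ hq s).aestronglyMeasurable
    (ae_of_all _ fun x => hqg s x)

variable [IsProbabilityMeasure ν]

lemma integrable_section_of_mem_classQ {q : I × U → ℝ} (hq : q ∈ classQ ν) (s : I) :
    Integrable (fun x => q (s, x)) ν :=
  (memLp_section_of_mem_classQ hq s).integrable (by norm_num)

/-- The map `q ↦ q - ν(q)`, which centers every section of `q`. -/
noncomputable def centeredSection (ν : Measure U) [IsProbabilityMeasure ν] :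
    classQSubmodule ν →ₗ[ℝ] (I × U → ℝ) where
  toFun q p := q.1 p - ∫ x, q.1 (p.1, x) ∂ν
  map_add' q₁ q₂ := by
    ext p
    simp only [Submodule.coe_add, Pi.add_apply]
    rw [integral_add (integrable_section_of_mem_classQ q₁.2 _)
      (integrable_section_of_mem_classQ q₂.2 _)]
    ring
  map_smul' c q := by
    ext p
    simp only [Submodule.coe_smul, Pi.smul_apply, smul_eq_mul, integral_const_mul,
      RingHom.id_apply]
    ring

lemma centeredSection_apply (q : classQSubmodule ν) (p : I × U) :
    centeredSection ν q p = q.1 p - ∫ x, q.1 (p.1, x) ∂ν := rfl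

lemma measurable_integral_section {q : I × U → ℝ} (hq : q ∈ classQ ν) :
    Measurable fun s => ∫ x, q (s, x) ∂ν :=
  (StronglyMeasurable.integral_prod_right (ν := ν) (f := fun s x => q (s, x))
    hq.1.stronglyMeasurable).measurable

lemma measurable_centeredSection (q : classQSubmodule ν) : Measurable (centeredSection ν q) :=
  q.2.1.sub ((measurable_integral_section q.2).comp measurable_fst)

lemma exists_memLp_bound_centeredSection (q : classQSubmodule ν) :
    ∃ G : U → ℝ, MemLp G 2 ν ∧ ∀ (s : I) (x : U), |centeredSection ν q (s, x)| ≤ G x := by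
  obtain ⟨g, hg, hqg⟩ := q.2.2.1
  refine ⟨fun x => g x + ∫ y, g y ∂ν, hg.add (memLp_const _), fun s x => ?_⟩
  refine (abs_sub _ _).trans (add_le_add (hqg s x) ?_)
  exact norm_integral_le_of_norm_le (f := fun y => q.1 (s, y)) (hg.integrable (by norm_num))
    (ae_of_all _ fun y => hqg s y)

lemma memLp_centeredSection (μ : Measure I) [IsFiniteMeasure μ] (q : classQSubmodule ν) :
    MemLp (centeredSection ν q) 2 (μ.prod ν) := by
  obtain ⟨G, hG, hq⟩ := exists_memLp_bound_centeredSection q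
  exact (hG.comp_snd μ).mono' (measurable_centeredSection q).aestronglyMeasurable
    (ae_of_all _ fun p => hq p.1 p.2)

lemma integral_centeredSection (q : classQSubmodule ν) (s : I) :
    ∫ x, centeredSection ν q (s, x) ∂ν = 0 := by
  simp only [centeredSection_apply]
  rw [integral_sub (integrable_section_of_mem_classQ q.2 s) (integrable_const _)]
  simp

lemma integral_centeredSection_mul (q₁ q₂ : classQSubmodule ν) (s : I) :
    ∫ x, centeredSection ν q₁ (s, x) * centeredSection ν q₂ (s, x) ∂ν =
      (∫ x, q₁.1 (s, x) * q₂.1 (s, x) ∂ν) - (∫ x, q₁.1 (s, x) ∂ν) * ∫ x, q₂.1 (s, x) ∂ν :=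
  covariance_eq_sub (memLp_section_of_mem_classQ q₁.2 s) (memLp_section_of_mem_classQ q₂.2 s)

/-- The class in `L²(λ ⊗ ν)` of the centered function `q - ν(q)`. -/
noncomputable def centeredLp (ν : Measure U) [IsProbabilityMeasure ν] :
    classQSubmodule ν →ₗ[ℝ] Lp ℝ 2 ((volume : Measure I).prod ν) where
  toFun q := (memLp_centeredSection volume q).toLp
  map_add' q₁ q₂ := by
    rw [← MemLp.toLp_add]
    congr 1
    exact map_add _ _ _
  map_smul' c q := by
    rw [RingHom.id_apply, ← MemLp.toLp_const_smul]
    congr 1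
    exact map_smul _ _ _

/-- By Fubini the inner product integrates over `s` the covariance under `ν` of the two sections at
`s`. -/
lemma inner_centeredLp (q₁ q₂ : classQSubmodule ν) :
    inner ℝ (centeredLp ν q₁) (centeredLp ν q₂) = kieferCov ν q₁.1 q₂.1 := by
  have h₁ := memLp_centeredSection volume q₁
  have h₂ := memLp_centeredSection volume q₂
  have h : inner ℝ (centeredLp ν q₁) (centeredLp ν q₂) =
      ∫ p, centeredSection ν q₁ p * centeredSection ν q₂ p ∂((volume : Measure I).prod ν) := by
    rw [L2.inner_def]
    refine integral_congr_ae ?_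
    filter_upwards [h₁.coeFn_toLp, h₂.coeFn_toLp] with p e₁ e₂
    change inner ℝ (h₁.toLp _ p) (h₂.toLp _ p) = _
    rw [e₁, e₂, real_inner_eq_re_inner, RCLike.inner_apply]
    simp [mul_comm]
  refine h.trans ((integral_prod _ (h₁.integrable_mul h₂)).trans ?_)
  exact integral_congr_ae (ae_of_all _ fun s => integral_centeredSection_mul q₁ q₂ s)

end ClassQ

/-! ### Riemann sums and convergence of the averaged variances. -/

section RiemannSum

open Topology

/-- The point `⌈n x⌉ / n`, projected to `[0, 1]`. -/
noncomputable def ceilGrid (n : ℕ) (x : ℝ) : I :=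
  Set.projIcc 0 1 zero_le_one (⌈n * x⌉ / n : ℝ)

lemma measurable_ceilGrid (n : ℕ) : Measurable (ceilGrid n) := by
  have h : Measurable fun x : ℝ => (⌈n * x⌉ / n : ℝ) := by fun_prop
  exact continuous_projIcc.measurable.comp h

lemma tendsto_ceilGrid (s : I) : Tendsto (fun n : ℕ => ceilGrid n s) atTop (𝓝 s) := by
  have h : Tendsto (fun n : ℕ => (⌈n * (s : ℝ)⌉ / n : ℝ)) atTop (𝓝 (s : ℝ)) := by
    have h₁ : Tendsto (fun n : ℕ => (s : ℝ) + 1 / (n : ℝ)) atTop (𝓝 ((s : ℝ) + 0)) :=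
      tendsto_const_nhds.add tendsto_one_div_atTop_nhds_zero_nat
    rw [add_zero] at h₁
    refine tendsto_of_tendsto_of_tendsto_of_le_of_le' tendsto_const_nhds h₁ ?_ ?_
    · filter_upwards [eventually_gt_atTop 0] with n hn
      have hn' : (0 : ℝ) < n := by exact_mod_cast hn
      rw [le_div_iff₀ hn', mul_comm]
      exact Int.le_ceil _
    · filter_upwards [eventually_gt_atTop 0] with n hn
      have hn' : (0 : ℝ) < n := by exact_mod_cast hn
      rw [div_le_iff₀ hn', add_mul, one_div, inv_mul_cancel₀ hn'.ne', mul_comm (s : ℝ)]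
      exact (Int.ceil_lt_add_one _).le
  have h₂ := (continuous_projIcc (h := zero_le_one' ℝ)).continuousAt.tendsto.comp h
  rw [Set.projIcc_val] at h₂
  exact h₂

lemma ceilGrid_eq_gridPoint {n : ℕ} (i : Fin n) {x : ℝ} (h₀ : (i / n : ℝ) < x)
    (h₁ : x ≤ ((i : ℕ) + 1 : ℝ) / n) : ceilGrid n x = gridPoint n i := by
  have hn : (0 : ℝ) < n := by exact_mod_cast i.pos
  have h : ⌈n * x⌉ = (i : ℤ) + 1 := by
    rw [Int.ceil_eq_iff]
    rw [div_lt_iff₀ hn] at h₀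
    rw [le_div_iff₀ hn] at h₁
    push_cast
    constructor <;> linarith
  have hv : (⌈n * x⌉ / n : ℝ) = (gridPoint n i : ℝ) := by
    rw [h]
    simp [gridPoint]
  rw [ceilGrid, hv, Set.projIcc_val]

/-- `ceilGrid n` is constant on each `(i/n, (i+1)/n]`, so a Riemann sum is exactly an integral over
`[0, 1]` and dominated convergence becomes available. -/
lemma integral_comp_ceilGrid {n : ℕ} (hn : n ≠ 0) (f : I → ℝ) :
    ∫ s : I, f (ceilGrid n s) = (n : ℝ)⁻¹ * ∑ i : Fin n, f (gridPoint n i) := by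
  have hn' : (0 : ℝ) < n := by positivity
  have hlen (k : ℕ) : (((k + 1 : ℕ) / n : ℝ)) - (k / n : ℝ) = (n : ℝ)⁻¹ := by
    push_cast
    field_simp
    ring
  have hle (k : ℕ) : (k / n : ℝ) ≤ ((k + 1 : ℕ) / n : ℝ) := by
    have := hlen k
    have : 0 < (n : ℝ)⁻¹ := by positivity
    linarith
  have hcongr (i : Fin n) : Set.EqOn (fun x => f (ceilGrid n x)) (fun _ => f (gridPoint n i))
      (Set.Ioc (i / n : ℝ) ((i + 1 : ℕ) / n : ℝ)) := fun x hx => by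
    have h₁ := hx.2
    push_cast at h₁
    simp only [ceilGrid_eq_gridPoint i hx.1 h₁]
  have hint (k : ℕ) (hk : k < n) : IntervalIntegrable (fun x => f (ceilGrid n x)) volume
      (k / n : ℝ) ((k + 1 : ℕ) / n : ℝ) := by
    rw [intervalIntegrable_iff_integrableOn_Ioc_of_le (hle k)]
    refine (integrableOn_congr_fun (hcongr ⟨k, hk⟩) measurableSet_Ioc).2 ?_
    exact integrableOn_const (by simp)
  have hval (i : Fin n) : ∫ x in (i / n : ℝ)..((i + 1 : ℕ) / n : ℝ), f (ceilGrid n x) =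
      (n : ℝ)⁻¹ * f (gridPoint n i) := by
    rw [intervalIntegral.integral_of_le (hle i),
      setIntegral_congr_fun measurableSet_Ioc (hcongr i),
      ← intervalIntegral.integral_of_le (hle i), intervalIntegral.integral_const, hlen,
      smul_eq_mul]
  have hsum := intervalIntegral.sum_integral_adjacent_intervals (μ := volume)
    (a := fun k : ℕ => (k / n : ℝ)) (n := n) hint
  rw [unitInterval.measurePreserving_coe.integral_comp unitInterval.measurableEmbedding_coe
    (fun x => f (ceilGrid n x)), integral_Icc_eq_integral_Ioc,
    ← intervalIntegral.integral_of_le zero_le_one, Finset.mul_sum,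
    ← Finset.sum_congr rfl fun i _ => hval i, Fin.sum_univ_eq_sum_range
      (fun k => ∫ x in (k / n : ℝ)..((k + 1 : ℕ) / n : ℝ), f (ceilGrid n x)) n, hsum]
  simp [hn'.ne']

/-- Riemann sums of a bounded, almost everywhere continuous function converge to its integral. -/
lemma tendsto_riemannSum {f : I → ℝ} (hf : Measurable f) {C : ℝ} (hC : ∀ s, |f s| ≤ C)
    (hc : ∀ᵐ s : I, ContinuousAt f s) :
    Tendsto (fun n : ℕ => (n : ℝ)⁻¹ * ∑ i : Fin n, f (gridPoint n i)) atTop (𝓝 (∫ s, f s)) := by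
  have h : Tendsto (fun n : ℕ => ∫ s : I, f (ceilGrid n s)) atTop (𝓝 (∫ s, f s)) := by
    refine tendsto_integral_of_dominated_convergence (fun _ => C) (fun n => ?_)
      (integrable_const C) (fun n => ae_of_all _ fun s => hC _) ?_
    · exact (hf.comp ((measurable_ceilGrid n).comp measurable_subtype_coe)).aestronglyMeasurable
    · filter_upwards [hc] with s hs
      exact hs.tendsto.comp (tendsto_ceilGrid s)
  refine h.congr' ?_
  filter_upwards [eventually_ne_atTop 0] with n hn
  exact integral_comp_ceilGrid hn f

/-- After exchanging the integrals, the Riemann sums converge for each fixed `v` and are dominated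
by `G v`. Continuity of `s ↦ ∫ F (s, v) ∂κ` is never needed. -/
lemma tendsto_riemannSum_integral {V : Type*} [MeasurableSpace V] {κ : Measure V}
    [SFinite κ] {F : I × V → ℝ} (hF : Measurable F) {G : V → ℝ} (hG : Integrable G κ)
    (hFG : ∀ s v, |F (s, v)| ≤ G v) (hc : ∀ v, ∀ᵐ s : I, ContinuousAt (fun t => F (t, v)) s) :
    Tendsto (fun n : ℕ => (n : ℝ)⁻¹ * ∑ i : Fin n, ∫ v, F (gridPoint n i, v) ∂κ) atTop
      (𝓝 (∫ s, ∫ v, F (s, v) ∂κ)) := by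
  have hsec (s : I) : Measurable fun v => F (s, v) := hF.comp measurable_prodMk_left
  have hint (s : I) : Integrable (fun v => F (s, v)) κ :=
    hG.mono' (hsec s).aestronglyMeasurable (ae_of_all _ fun v => hFG s v)
  have hprod : Integrable F ((volume : Measure I).prod κ) :=
    (hG.comp_snd volume).mono' hF.aestronglyMeasurable (ae_of_all _ fun p => hFG p.1 p.2)
  rw [integral_integral_swap (f := fun s v => F (s, v)) hprod]
  have hpt (n : ℕ) : (n : ℝ)⁻¹ * ∑ i : Fin n, ∫ v, F (gridPoint n i, v) ∂κ =
      ∫ v, (n : ℝ)⁻¹ * ∑ i : Fin n, F (gridPoint n i, v) ∂κ := by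
    rw [integral_const_mul, integral_finsetSum _ fun i _ => hint _]
  simp_rw [hpt]
  refine tendsto_integral_of_dominated_convergence G (fun n => ?_) hG (fun n => ?_) ?_
  · exact (measurable_const.mul
      (Finset.measurable_sum _ fun i _ => hsec (gridPoint n i))).aestronglyMeasurable
  · refine ae_of_all _ fun v => ?_
    rcases eq_or_ne n 0 with rfl | hn
    · simpa using (abs_nonneg _).trans (hFG 0 v)
    have hn' : (0 : ℝ) < n := by positivity
    calc ‖(n : ℝ)⁻¹ * ∑ i : Fin n, F (gridPoint n i, v)‖
        ≤ (n : ℝ)⁻¹ * ∑ i : Fin n, |F (gridPoint n i, v)| := by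
          rw [norm_mul, Real.norm_of_nonneg (by positivity)]
          gcongr
          exact Finset.abs_sum_le_sum_abs _ _
      _ ≤ (n : ℝ)⁻¹ * ∑ _i : Fin n, G v := by gcongr; exact hFG _ _
      _ = G v := by simp [hn'.ne']
  · exact ae_of_all _ fun v => tendsto_riemannSum (hF.comp measurable_prodMk_right)
      (fun s => hFG s v) (hc v)

variable {U : Type*} [MeasurableSpace U] {ν : Measure U} [IsProbabilityMeasure ν]

/-- The averages of the variances of the summands converge to the limiting variance. -/
lemma tendsto_average_integral_sq_centeredSection (q : classQSubmodule ν) :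
    Tendsto (fun n : ℕ => (n : ℝ)⁻¹ *
      ∑ i : Fin n, ∫ x, centeredSection ν q (gridPoint n i, x) ^ 2 ∂ν) atTop
      (𝓝 (kieferCov ν q.1 q.1)) := by
  obtain ⟨g, hg, hqg⟩ := q.2.2.1
  have hgi : Integrable g ν := hg.integrable (by norm_num)
  have habs (s : I) (x y : U) : |q.1 (s, x) * q.1 (s, y)| ≤ g x * g y := by
    rw [abs_mul]
    exact mul_le_mul (hqg s x) (hqg s y) (abs_nonneg _) ((abs_nonneg _).trans (hqg s x))
  have hm₂ : Measurable fun p : I × (U × U) => q.1 (p.1, p.2.1) * q.1 (p.1, p.2.2) := by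
    have := q.2.1
    fun_prop
  have h₁ := tendsto_riemannSum_integral (κ := ν) (F := fun p => q.1 p * q.1 p)
    (q.2.1.mul q.2.1) (hg.integrable_mul hg) (fun s x => habs s x x)
    (fun x => by filter_upwards [q.2.2.2 x] with s hs using hs.mul hs)
  -- The square `ν(q)(s)²` is written as a double integral of `q(s, x) q(s, y)`; for fixed `(x, y)`
  -- the discontinuities in `s` lie in the union of two null sets.
  have h₂ := tendsto_riemannSum_integral (κ := ν.prod ν) hm₂ (hgi.mul_prod hgi)
    (fun s v => habs s v.1 v.2)
    (fun v => by filter_upwards [q.2.2.2 v.1, q.2.2.2 v.2] with s hs hs' using hs.mul hs')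
  have hsplit (s : I) : ∫ v : U × U, q.1 (s, v.1) * q.1 (s, v.2) ∂(ν.prod ν) =
      (∫ x, q.1 (s, x) ∂ν) * ∫ x, q.1 (s, x) ∂ν :=
    integral_prod_mul (fun x => q.1 (s, x)) fun x => q.1 (s, x)
  simp only [hsplit] at h₂
  have hlim : kieferCov ν q.1 q.1 = (∫ s : I, ∫ x, q.1 (s, x) * q.1 (s, x) ∂ν) -
      ∫ s : I, (∫ x, q.1 (s, x) ∂ν) * ∫ x, q.1 (s, x) ∂ν := by
    refine integral_sub ?_ ?_
    · have : Integrable (fun p => q.1 p * q.1 p) ((volume : Measure I).prod ν) :=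
        ((hg.integrable_mul hg).comp_snd volume).mono' (q.2.1.mul q.2.1).aestronglyMeasurable
          (ae_of_all _ fun p => habs p.1 p.2 p.2)
      exact this.integral_prod_left
    · have hm := measurable_integral_section q.2
      refine (integrable_const ((∫ y, g y ∂ν) * ∫ y, g y ∂ν)).mono'
        (hm.mul hm).aestronglyMeasurable (ae_of_all _ fun s => ?_)
      have hb : |∫ x, q.1 (s, x) ∂ν| ≤ ∫ y, g y ∂ν :=
        norm_integral_le_of_norm_le (f := fun x => q.1 (s, x)) hgi (ae_of_all _ fun y => hqg s y)
      rw [Real.norm_eq_abs, abs_mul]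
      exact mul_le_mul hb hb (abs_nonneg _) ((abs_nonneg _).trans hb)
  rw [hlim]
  refine (h₁.sub h₂).congr fun n => ?_
  rw [← mul_sub, ← Finset.sum_sub_distrib]
  simp_rw [sq, integral_centeredSection_mul]

end RiemannSum

/-! ### Lindeberg's argument with characteristic functions. -/

section Lindeberg

open Topology

/-- For `|x| ≤ 1` this is the cubic Taylor remainder with `e ≤ 4`; for `|x| ≥ 1` the triangle
inequality gives `2 + |x| + x²/2 ≤ 4x²`. The minimum lets second moments suffice. -/
lemma norm_cexp_mul_I_sub_taylor_two_le (x : ℝ) :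
    ‖Complex.exp (x * Complex.I) - (1 + x * Complex.I - x ^ 2 / 2)‖ ≤ 4 * (x ^ 2 * min 1 |x|) := by
  rcases le_total |x| 1 with h | h
  · have h₁ := Complex.norm_exp_sub_sum_le_norm_mul_exp (x * Complex.I) 3
    have h₂ : ∑ m ∈ Finset.range 3, (x * Complex.I) ^ m / (m.factorial : ℂ) =
        1 + x * Complex.I - x ^ 2 / 2 := by
      simp [Finset.sum_range_succ, mul_pow]
      ring
    rw [h₂] at h₁
    have h₃ : ‖(x * Complex.I : ℂ)‖ = |x| := by simp
    rw [h₃] at h₁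
    have h₄ : Real.exp |x| ≤ 4 :=
      (Real.exp_le_exp.2 h).trans (by linarith [Real.exp_one_lt_d9])
    rw [min_eq_right h]
    calc _ ≤ |x| ^ 3 * Real.exp |x| := h₁
      _ ≤ |x| ^ 3 * 4 := by gcongr
      _ = 4 * (x ^ 2 * |x|) := by rw [← sq_abs x]; ring
  · rw [min_eq_left h]
    have h₁ : ‖Complex.exp (x * Complex.I)‖ = 1 := Complex.norm_exp_ofReal_mul_I x
    have h₂ : ‖(1 + x * Complex.I - x ^ 2 / 2 : ℂ)‖ ≤ 1 + |x| + |x| ^ 2 / 2 := by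
      refine (norm_sub_le _ _).trans (add_le_add ((norm_add_le _ _).trans (by simp)) (by simp))
    refine (norm_sub_le _ _).trans ?_
    rw [h₁, ← sq_abs x]
    nlinarith

lemma abs_exp_neg_sub_one_sub_le {a : ℝ} (ha : 0 ≤ a) : |Real.exp (-a) - (1 - a)| ≤ a ^ 2 := by
  rcases le_total a 1 with h | h
  · have := Real.abs_exp_sub_one_sub_id_le (x := -a) (by rwa [abs_neg, abs_of_nonneg ha])
    rw [neg_sq] at this
    convert this using 2
    ring
  · rw [abs_of_nonneg (by linarith [Real.add_one_le_exp (-a)])]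
    have := Real.exp_le_one_iff.2 (neg_nonpos.2 ha)
    nlinarith

/-- Telescoping: factors are exchanged one at a time, the others having norm at most `1`. -/
lemma norm_prod_sub_prod_le_sum {ι : Type*} (s : Finset ι) {a b : ι → ℂ}
    (ha : ∀ i, ‖a i‖ ≤ 1) (hb : ∀ i, ‖b i‖ ≤ 1) :
    ‖∏ i ∈ s, a i - ∏ i ∈ s, b i‖ ≤ ∑ i ∈ s, ‖a i - b i‖ := by
  classical
  induction s using Finset.induction with
  | empty => simp
  | insert i s hi ih =>
    rw [Finset.prod_insert hi, Finset.prod_insert hi, Finset.sum_insert hi]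
    have h : a i * ∏ j ∈ s, a j - b i * ∏ j ∈ s, b j =
        (a i - b i) * ∏ j ∈ s, a j + b i * (∏ j ∈ s, a j - ∏ j ∈ s, b j) := by ring
    have hp : ‖∏ j ∈ s, a j‖ ≤ 1 := by
      rw [norm_prod]
      exact Finset.prod_le_one (fun _ _ => norm_nonneg _) fun j _ => ha j
    rw [h]
    refine (norm_add_le _ _).trans (add_le_add ?_ ?_) <;> rw [norm_mul]
    · exact mul_le_of_le_one_right (norm_nonneg _) hp
    · exact (mul_le_of_le_one_left (norm_nonneg _) (hb i)).trans ih

variable {U : Type*} [MeasurableSpace U] {ν : Measure U} [IsProbabilityMeasure ν]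

/-- Integrate the pointwise Taylor bound; centering removes the linear term. -/
lemma norm_charFun_map_one_sub_le {Y : U → ℝ} (hY : MemLp Y 2 ν) (h₀ : ∫ x, Y x ∂ν = 0) :
    ‖charFun (ν.map Y) 1 - (1 - (∫ x, Y x ^ 2 ∂ν) / 2 : ℝ)‖ ≤
      4 * ∫ x, Y x ^ 2 * min 1 |Y x| ∂ν := by
  have hm : AEStronglyMeasurable Y ν := hY.aestronglyMeasurable
  have hY₁ : Integrable Y ν := hY.integrable (by norm_num)
  have hY₂ : Integrable (fun x => Y x ^ 2) ν := hY.integrable_sq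
  have hexp : Integrable (fun x => Complex.exp (Y x * Complex.I)) ν :=
    (integrable_const (1 : ℝ)).mono' (by fun_prop) (ae_of_all _ fun x => by
      rw [Complex.norm_exp_ofReal_mul_I])
  have htay : Integrable (fun x => (1 + Y x * Complex.I - (Y x : ℂ) ^ 2 / 2)) ν := by
    refine ((integrable_const _).add (hY₁.ofReal.mul_const _)).sub (Integrable.div_const ?_ _)
    simpa using hY₂.ofReal (𝕜 := ℂ)
  have hmin : Integrable (fun x => Y x ^ 2 * min 1 |Y x|) ν := by
    refine hY₂.mono' ?_ (ae_of_all _ fun x => ?_)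
    · exact (hm.pow 2).mul (aestronglyMeasurable_const.inf hm.norm)
    · rw [Real.norm_of_nonneg (by positivity)]
      exact mul_le_of_le_one_right (by positivity) (min_le_left _ _)
  have h₁ : charFun (ν.map Y) 1 = ∫ x, Complex.exp (Y x * Complex.I) ∂ν := by
    rw [charFun_apply_real, integral_map hm.aemeasurable (by fun_prop)]
    simp
  have h₂ : ∫ x, (1 + Y x * Complex.I - (Y x : ℂ) ^ 2 / 2) ∂ν =
      ((1 - (∫ x, Y x ^ 2 ∂ν) / 2 : ℝ) : ℂ) := by
    have e : ∫ x, (Y x : ℂ) ^ 2 ∂ν = ((∫ x, Y x ^ 2 ∂ν : ℝ) : ℂ) := by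
      rw [← integral_complex_ofReal]
      simp
    have hi : Integrable (fun x => (Y x : ℂ) ^ 2 / 2) ν := by
      refine Integrable.div_const ?_ _
      simpa using hY₂.ofReal (𝕜 := ℂ)
    have hl : Integrable (fun x => (Y x : ℂ) * Complex.I) ν := hY₁.ofReal.mul_const _
    have hc : Integrable (fun x => 1 + (Y x : ℂ) * Complex.I) ν := (integrable_const _).add hl
    rw [integral_sub hc hi, integral_add (integrable_const _) hl, integral_mul_const,
      integral_div, integral_complex_ofReal, h₀, e]
    simp
  rw [h₁, ← h₂, ← integral_sub hexp htay, ← integral_const_mul]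
  exact norm_integral_le_of_norm_le (hmin.const_mul 4)
    (ae_of_all _ fun x => norm_cexp_mul_I_sub_taylor_two_le (Y x))

lemma integrable_sq_mul_min {ν : Measure U} {G : U → ℝ} (hG : MemLp G 2 ν) (c : ℝ) (hc : 0 ≤ c) :
    Integrable (fun x => G x ^ 2 * min 1 (c * |G x|)) ν := by
  refine hG.integrable_sq.mono' ?_ (ae_of_all _ fun x => ?_)
  · exact (hG.1.pow 2).mul (aestronglyMeasurable_const.inf (hG.1.norm.const_mul c))
  · rw [Real.norm_of_nonneg (by positivity)]
    exact mul_le_of_le_one_right (by positivity) (min_le_left _ _)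

/-- The Lindeberg condition for the envelope: dominated convergence with dominating function `G²`.
-/
lemma tendsto_integral_sq_mul_min {ν : Measure U} {G : U → ℝ} (hG : MemLp G 2 ν) :
    Tendsto (fun n : ℕ => ∫ x, G x ^ 2 * min 1 ((√n)⁻¹ * |G x|) ∂ν) atTop (𝓝 0) := by
  have hs : Tendsto (fun n : ℕ => (√(n : ℝ))⁻¹) atTop (𝓝 0) :=
    tendsto_inv_atTop_zero.comp (Real.tendsto_sqrt_atTop.comp tendsto_natCast_atTop_atTop)
  rw [← integral_zero U ℝ (μ := ν)]
  refine tendsto_integral_of_dominated_convergence (fun x => G x ^ 2)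
    (fun n => (integrable_sq_mul_min hG _ (by positivity)).1) hG.integrable_sq
    (fun n => ae_of_all _ fun x => ?_) (ae_of_all _ fun x => ?_)
  · rw [Real.norm_of_nonneg (by positivity)]
    exact mul_le_of_le_one_right (by positivity) (min_le_left _ _)
  · have h : Tendsto (fun n : ℕ => G x ^ 2 * min 1 ((√(n : ℝ))⁻¹ * |G x|)) atTop
        (𝓝 (G x ^ 2 * min 1 (0 * |G x|))) :=
      (tendsto_const_nhds.min (hs.mul_const _)).const_mul _
    simpa using h

/-- The error in comparing one factor of the characteristic function with a Gaussian one. -/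
lemma norm_charFun_map_sub_exp_le {G f : U → ℝ} (hG : MemLp G 2 ν) (hf : Measurable f)
    (hfG : ∀ x, |f x| ≤ G x) (h₀ : ∫ x, f x ∂ν = 0) {n : ℕ} (hn : n ≠ 0) :
    ‖charFun (ν.map fun x => (√n)⁻¹ * f x) 1 -
        Complex.exp (-((n : ℝ)⁻¹ * (∫ x, f x ^ 2 ∂ν) / 2 : ℝ))‖ ≤
      (n : ℝ)⁻¹ * (4 * ∫ x, G x ^ 2 * min 1 ((√n)⁻¹ * |G x|) ∂ν +
        (n : ℝ)⁻¹ * (∫ x, G x ^ 2 ∂ν) ^ 2) := by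
  have hn' : (0 : ℝ) < n := by positivity
  have hfm : MemLp f 2 ν := hG.mono' hf.aestronglyMeasurable (ae_of_all _ hfG)
  have hsq (x : U) : ((√(n : ℝ))⁻¹ * f x) ^ 2 = (n : ℝ)⁻¹ * f x ^ 2 := by
    rw [mul_pow, inv_pow, Real.sq_sqrt hn'.le]
  have habs (x : U) : |f x| ≤ |G x| := (hfG x).trans (le_abs_self _)
  have h₁ := norm_charFun_map_one_sub_le (hfm.const_mul (√(n : ℝ))⁻¹)
    (by rw [integral_const_mul, h₀, mul_zero])
  simp only [hsq, integral_const_mul] at h₁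
  -- `y² min(1, c|y|)` increases with `|y|` when `c ≥ 0`, so the envelope may replace `f`.
  have h₂ : ∫ x, (n : ℝ)⁻¹ * f x ^ 2 * min 1 |(√(n : ℝ))⁻¹ * f x| ∂ν ≤
      (n : ℝ)⁻¹ * ∫ x, G x ^ 2 * min 1 ((√n)⁻¹ * |G x|) ∂ν := by
    rw [← integral_const_mul]
    refine integral_mono_of_nonneg (ae_of_all _ fun x => by positivity)
      ((integrable_sq_mul_min hG _ (by positivity)).const_mul _) (ae_of_all _ fun x => ?_)
    have h : f x ^ 2 ≤ G x ^ 2 := sq_le_sq.2 (habs x)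
    simp only [abs_mul, abs_of_nonneg (inv_nonneg.2 (Real.sqrt_nonneg (n : ℝ))), mul_assoc]
    gcongr ?_ * (?_ * min 1 (?_ * ?_))
    · exact habs x
  have hle : ∫ x, f x ^ 2 ∂ν ≤ ∫ x, G x ^ 2 ∂ν :=
    integral_mono hfm.integrable_sq hG.integrable_sq fun x => sq_le_sq.2 (habs x)
  have hf₀ : 0 ≤ ∫ x, f x ^ 2 ∂ν := integral_nonneg fun x => sq_nonneg _
  have h₃ := abs_exp_neg_sub_one_sub_le (a := (n : ℝ)⁻¹ * (∫ x, f x ^ 2 ∂ν) / 2) (by positivity)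
  have h₄ : ((n : ℝ)⁻¹ * (∫ x, f x ^ 2 ∂ν) / 2) ^ 2 ≤
      (n : ℝ)⁻¹ * ((n : ℝ)⁻¹ * (∫ x, G x ^ 2 ∂ν) ^ 2) := by
    calc ((n : ℝ)⁻¹ * (∫ x, f x ^ 2 ∂ν) / 2) ^ 2 ≤ ((n : ℝ)⁻¹ * (∫ x, G x ^ 2 ∂ν)) ^ 2 := by
          gcongr
          exact (half_le_self (by positivity)).trans (by gcongr)
      _ = _ := by ring
  rw [← Real.norm_eq_abs, ← Complex.norm_real, Complex.ofReal_sub, norm_sub_rev,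
    Complex.ofReal_exp, Complex.ofReal_neg] at h₃
  refine (norm_sub_le_norm_sub_add_norm_sub _ _ _).trans ((add_le_add h₁ h₃).trans ?_)
  rw [mul_add]
  have := add_le_add (mul_le_mul_of_nonneg_left h₂ (by norm_num : (0 : ℝ) ≤ 4)) h₄
  linarith

variable {Ω : Type*} [MeasurableSpace Ω] {P : Measure Ω}

/-- Convergence of the characteristic function at `1` in the central limit theorem, for a
triangular array of centered functions of an i.i.d. sample with a common square-integrable bound
and convergent averages of the variances. -/
lemma tendsto_charFun_map_sum_triangular {X : ℕ → Ω → U} (hX : ∀ i, Measurable (X i))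
    (hindep : iIndepFun X P) (hlaw : ∀ i, P.map (X i) = ν) {G : U → ℝ} (hG : MemLp G 2 ν)
    {f : (n : ℕ) → Fin n → U → ℝ} (hf : ∀ n i, Measurable (f n i))
    (hfG : ∀ n i x, |f n i x| ≤ G x) (h₀ : ∀ n i, ∫ x, f n i x ∂ν = 0) {v : ℝ}
    (hv : Tendsto (fun n : ℕ => (n : ℝ)⁻¹ * ∑ i : Fin n, ∫ x, f n i x ^ 2 ∂ν) atTop (𝓝 v)) :
    Tendsto (fun n : ℕ => charFun (P.map fun ω => ∑ i : Fin n, (√n)⁻¹ * f n i (X i ω)) 1) atTop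
      (𝓝 (Complex.exp (-(v / 2 : ℝ)))) := by
  have hm (n : ℕ) (i : Fin n) : Measurable fun x => (√(n : ℝ))⁻¹ * f n i x :=
    (hf n i).const_mul _
  have hprod (n : ℕ) : charFun (P.map fun ω => ∑ i : Fin n, (√n)⁻¹ * f n i (X i ω)) 1 =
      ∏ i : Fin n, charFun (ν.map fun x => (√(n : ℝ))⁻¹ * f n i x) 1 := by
    have hi : iIndepFun (fun (i : Fin n) ω => (√(n : ℝ))⁻¹ * f n i (X i ω)) P :=
      (hindep.precomp Fin.val_injective).comp (fun i x => (√(n : ℝ))⁻¹ * f n i x) (hm n)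
    have hXm (i : Fin n) : AEMeasurable (fun ω => (√(n : ℝ))⁻¹ * f n i (X i ω)) P :=
      ((hm n i).comp (hX i)).aemeasurable
    rw [hi.charFun_map_fun_sum_eq_prod hXm, Finset.prod_apply]
    refine Finset.prod_congr rfl fun i _ => ?_
    rw [← hlaw i, Measure.map_map (hm n i) (hX i)]
    rfl
  have hgauss (n : ℕ) : ∏ i : Fin n,
      Complex.exp (-((n : ℝ)⁻¹ * (∫ x, f n i x ^ 2 ∂ν) / 2 : ℝ)) =
      Complex.exp (-(((n : ℝ)⁻¹ * ∑ i : Fin n, ∫ x, f n i x ^ 2 ∂ν) / 2 : ℝ)) := by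
    rw [← Complex.exp_sum, Finset.sum_neg_distrib, ← Complex.ofReal_sum, ← Finset.sum_div,
      Finset.mul_sum]
  have hbound : Tendsto (fun n : ℕ => 4 * ∫ x, G x ^ 2 * min 1 ((√(n : ℝ))⁻¹ * |G x|) ∂ν +
      (n : ℝ)⁻¹ * (∫ x, G x ^ 2 ∂ν) ^ 2) atTop (𝓝 0) := by
    have h := ((tendsto_integral_sq_mul_min hG).const_mul 4).add
      ((tendsto_inv_atTop_nhds_zero_nat (𝕜 := ℝ)).mul_const ((∫ x, G x ^ 2 ∂ν) ^ 2))
    simpa using h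
  have hdiff : Tendsto (fun n : ℕ =>
      charFun (P.map fun ω => ∑ i : Fin n, (√n)⁻¹ * f n i (X i ω)) 1 -
        Complex.exp (-(((n : ℝ)⁻¹ * ∑ i : Fin n, ∫ x, f n i x ^ 2 ∂ν) / 2 : ℝ))) atTop (𝓝 0) := by
    -- Each of the `n` factors contributes at most `n⁻¹` times the quantity in `hbound`, so the
    -- total is at most that quantity.
    refine squeeze_zero_norm' ?_ hbound
    filter_upwards [eventually_ne_atTop 0] with n hn
    have hn' : (n : ℝ) ≠ 0 := by exact_mod_cast hn
    rw [hprod, ← hgauss]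
    refine (norm_prod_sub_prod_le_sum _ (fun i => ?_) fun i => ?_).trans ?_
    · have : IsProbabilityMeasure (ν.map fun x => (√(n : ℝ))⁻¹ * f n i x) :=
        Measure.isProbabilityMeasure_map (hm n i).aemeasurable
      exact norm_charFun_le_one _
    · rw [← Complex.ofReal_neg, Complex.norm_exp_ofReal, Real.exp_le_one_iff, neg_nonpos]
      have : 0 ≤ ∫ x, f n i x ^ 2 ∂ν := integral_nonneg fun x => sq_nonneg _
      positivity
    · refine (Finset.sum_le_sum fun i _ =>
        norm_charFun_map_sub_exp_le hG (hf n i) (hfG n i) (h₀ n i) hn).trans ?_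
      rw [Finset.sum_const, Finset.card_univ, Fintype.card_fin, nsmul_eq_mul,
        mul_inv_cancel_left₀ hn']
  have hexp : Continuous fun y : ℝ => Complex.exp (-(y / 2 : ℝ)) := by fun_prop
  have h := hdiff.add ((hexp.tendsto v).comp hv)
  rw [zero_add] at h
  refine h.congr fun n => ?_
  simp

end Lindeberg

/-! ### Isometric embedding of a Hilbert space into Gaussian variables. -/

section Isonormal

open Topology

variable {Ω : Type*} [MeasurableSpace Ω] {P : Measure Ω}

lemma norm_cexp_mul_I_sub_le (a b : ℝ) :
    ‖Complex.exp (a * Complex.I) - Complex.exp (b * Complex.I)‖ ≤ |a - b| := by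
  have h : Complex.exp (a * Complex.I) - Complex.exp (b * Complex.I) =
      Complex.exp (b * Complex.I) * (Complex.exp (Complex.I * (a - b : ℝ)) - 1) := by
    rw [mul_sub, ← Complex.exp_add, mul_one]
    congr 2
    push_cast
    ring
  rw [h, norm_mul, Complex.norm_exp_ofReal_mul_I, one_mul]
  exact Real.norm_exp_I_mul_ofReal_sub_one_le

lemma charFun_map_lp (f : Lp ℝ 2 P) (t : ℝ) :
    charFun (P.map f) t = ∫ ω, Complex.exp ((t * f ω : ℝ) * Complex.I) ∂P := by
  rw [charFun_apply_real, integral_map (Lp.aestronglyMeasurable f).aemeasurable (by fun_prop)]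
  simp

variable [IsProbabilityMeasure P]

lemma integral_abs_lp_le (f : Lp ℝ 2 P) : ∫ ω, |f ω| ∂P ≤ ‖f‖ := by
  have h := Lp.memLp f
  have h₁ : ∫ ω, ‖f ω‖ ∂P = (eLpNorm f 1 P).toReal := by
    rw [eLpNorm_one_eq_lintegral_enorm, integral_norm_eq_lintegral_enorm h.1]
  have h₂ : eLpNorm f 1 P ≤ eLpNorm f 2 P := eLpNorm_le_eLpNorm_of_exponent_le (by norm_num) h.1
  calc ∫ ω, |f ω| ∂P = (eLpNorm f 1 P).toReal := h₁
    _ ≤ (eLpNorm f 2 P).toReal := ENNReal.toReal_mono h.2.ne h₂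
    _ = ‖f‖ := (Lp.norm_def f).symm

/-- Lipschitz with constant `|t|`, since `x ↦ e^{ix}` is 1-Lipschitz and the `L¹` norm is at most
the `L²` norm. It carries Gaussian laws from finite sums to `L²` limits. -/
lemma continuous_charFun_map_lp (t : ℝ) :
    Continuous fun f : Lp ℝ 2 P => charFun (P.map f) t := by
  have hint (f : Lp ℝ 2 P) :
      Integrable (fun ω => Complex.exp ((t * f ω : ℝ) * Complex.I)) P := by
    have := Lp.aestronglyMeasurable f
    exact (integrable_const (1 : ℝ)).mono' (by fun_prop) (ae_of_all _ fun x => by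
      rw [Complex.norm_exp_ofReal_mul_I])
  refine LipschitzWith.continuous (K := ‖t‖₊) (LipschitzWith.of_dist_le_mul fun f g => ?_)
  have hfg : Integrable (fun ω => |(f - g : Lp ℝ 2 P) ω|) P :=
    ((Lp.memLp (f - g)).integrable (by norm_num)).abs
  rw [dist_eq_norm, dist_eq_norm, charFun_map_lp, charFun_map_lp, ← integral_sub (hint f) (hint g)]
  calc _ ≤ ∫ ω, |t| * |(f - g : Lp ℝ 2 P) ω| ∂P := by
        refine norm_integral_le_of_norm_le (hfg.const_mul _) ?_
        filter_upwards [Lp.coeFn_sub f g] with ω hω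
        rw [hω, Pi.sub_apply, ← abs_mul, mul_sub]
        exact norm_cexp_mul_I_sub_le _ _
    _ = |t| * ∫ ω, |(f - g : Lp ℝ 2 P) ω| ∂P := integral_const_mul _ _
    _ ≤ ‖t‖₊ * ‖f - g‖ := by
        simpa using mul_le_mul_of_nonneg_left (integral_abs_lp_le (f - g)) (abs_nonneg t)

universe u

/-- Every real Hilbert space embeds isometrically into an `L²` space as a family of centered
Gaussian variables. -/
lemma exists_isonormal (H : Type u) [NormedAddCommGroup H] [InnerProductSpace ℝ H]
    [CompleteSpace H] :
    ∃ (ι : Type u) (P : Measure (ι → ℝ)) (_ : IsProbabilityMeasure P) (W : H →ₗᵢ[ℝ] Lp ℝ 2 P),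
      ∀ h, P.map (W h) = gaussianReal 0 (‖h‖₊ ^ 2) := by
  obtain ⟨ι, b, -⟩ := exists_hilbertBasis ℝ H
  -- One independent standard Gaussian coordinate per basis vector; these coordinates are
  -- orthonormal in `L²(P)`, and `W` sends the basis to them.
  let P : Measure (ι → ℝ) := Measure.infinitePi fun _ => gaussianReal 0 1
  have hlaw (i : ι) : HasLaw (fun ω : ι → ℝ => ω i) (gaussianReal 0 1) P :=
    ⟨(measurable_pi_apply i).aemeasurable, (measurePreserving_eval_infinitePi _ i).map_eq⟩
  have hind : iIndepFun (fun (i : ι) (ω : ι → ℝ) => ω i) P :=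
    iIndepFun_infinitePi (X := fun _ => id) (fun _ => measurable_id)
  have hgauss (i : ι) : HasGaussianLaw (fun ω : ι → ℝ => ω i) P := (hlaw i).hasGaussianLaw
  have hmem (i : ι) : MemLp (fun ω : ι → ℝ => ω i) 2 P := (hgauss i).memLp_two
  have hmean (i : ι) : ∫ ω, ω i ∂P = 0 := by
    have := (hlaw i).integral_eq
    simpa using this
  have hvar (i : ι) : ∫ ω, ω i * ω i ∂P = 1 := by
    have h := (hlaw i).variance_eq
    rw [variance_id_gaussianReal, variance_eq_sub (hmem i)] at h
    simpa [hmean, sq] using h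
  let ξ (i : ι) : Lp ℝ 2 P := (hmem i).toLp
  have hξ : Orthonormal ℝ ξ := by
    classical
    rw [orthonormal_iff_ite]
    intro i j
    have hij : inner ℝ (ξ i) (ξ j) = ∫ ω, ω i * ω j ∂P := by
      rw [L2.inner_def]
      refine integral_congr_ae ?_
      filter_upwards [(hmem i).coeFn_toLp, (hmem j).coeFn_toLp] with ω e₁ e₂
      simp only [ξ, e₁, e₂]
      simp [mul_comm]
    rw [hij]
    split_ifs with h
    · subst h
      exact hvar i
    · have := (hind.indepFun h).integral_fun_mul_eq_mul_integral
        (hmem i).1 (hmem j).1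
      rw [this, hmean, zero_mul]
  have hfin (s : Finset ι) (c : ι → ℝ) (t : ℝ) :
      charFun (P.map (∑ i ∈ s, c i • ξ i : Lp ℝ 2 P)) t =
        Complex.exp (-(t ^ 2 * ‖∑ i ∈ s, c i • ξ i‖ ^ 2 / 2 : ℝ)) := by
    set f : Lp ℝ 2 P := ∑ i ∈ s, c i • ξ i with hf
    have hae : (fun ω : ι → ℝ => ∑ i : s, c i * ω i) =ᵐ[P] f := by
      have h₁ : ∀ᵐ ω ∂P, ∀ i ∈ s, ξ i ω = ω i :=
        (Finset.eventually_all s).2 fun i _ => (hmem i).coeFn_toLp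
      have h₂ : ∀ᵐ ω ∂P, ∀ i ∈ s, (c i • ξ i : Lp ℝ 2 P) ω = c i * ξ i ω :=
        (Finset.eventually_all s).2 fun i _ => Lp.coeFn_smul (c i) (ξ i)
      filter_upwards [h₁, h₂, Lp.coeFn_finsetSum s fun i => c i • ξ i] with ω e₁ e₂ e₃
      rw [hf, e₃, Finset.sum_apply, Finset.sum_coe_sort s fun i => c i * ω i]
      exact Finset.sum_congr rfl fun i hi => by rw [e₂ i hi, e₁ i hi]
    have hg : HasGaussianLaw f P := by
      refine HasGaussianLaw.congr ?_ hae
      have h₁ : HasGaussianLaw (fun (ω : ι → ℝ) (i : s) => ω i) P :=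
        iIndepFun.hasGaussianLaw (fun i => hgauss i) (hind.precomp Subtype.val_injective)
      have h₂ : (fun ω : ι → ℝ => ∑ i : s, c i * ω i) =
          (∑ i : s, c i • ContinuousLinearMap.proj i : (s → ℝ) →L[ℝ] ℝ) ∘ fun ω i => ω i := by
        ext ω
        simp
      rw [h₂]
      exact h₁.map _
    have hm : ∫ ω, f ω ∂P = 0 := by
      rw [← integral_congr_ae hae, integral_finsetSum]
      · simp [integral_const_mul, hmean]
      · exact fun i _ => ((hmem i).integrable (by norm_num)).const_mul _
    have hv : Var[f; P] = ‖f‖ ^ 2 := by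
      rw [variance_of_integral_eq_zero hg.aemeasurable hm, ← real_inner_self_eq_norm_sq,
        L2.inner_def]
      refine integral_congr_ae (ae_of_all _ fun ω => ?_)
      simp [sq]
    rw [hg.map_eq_gaussianReal, hm, hv, charFun_gaussianReal]
    simp
    ring_nf
  let W : H →ₗᵢ[ℝ] Lp ℝ 2 P :=
    hξ.orthogonalFamily.linearIsometry.comp b.repr.toLinearIsometry
  have hWb (i : ι) : W (b i) = ξ i := by
    classical
    simp [W, HilbertBasis.repr_self]
  refine ⟨ι, P, inferInstance, W, fun h => ?_⟩
  have hchar (t : ℝ) : charFun (P.map (W h)) t =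
      Complex.exp (-(t ^ 2 * ‖W h‖ ^ 2 / 2 : ℝ)) := by
    -- `W h` is the `L²` limit of finite Gaussian sums, to which `hfin` applies; both sides of
    -- `hchar` are continuous in `L²`.
    have hsum : Tendsto (fun s : Finset ι => ∑ i ∈ s, b.repr h i • ξ i) atTop (𝓝 (W h)) := by
      have h₁ := (W.continuous.tendsto h).comp (b.hasSum_repr h)
      refine h₁.congr fun s => ?_
      simp [hWb]
    have h₁ := ((continuous_charFun_map_lp t).tendsto (W h)).comp hsum
    have h₂ : Continuous fun f : Lp ℝ 2 P =>
        Complex.exp (-(t ^ 2 * ‖f‖ ^ 2 / 2 : ℝ)) := by fun_prop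
    exact tendsto_nhds_unique h₁
      (((h₂.tendsto (W h)).comp hsum).congr fun s => (hfin s (b.repr h) t).symm)
  have : IsProbabilityMeasure (P.map (W h)) :=
    Measure.isProbabilityMeasure_map (Lp.aestronglyMeasurable _).aemeasurable
  refine Measure.ext_of_charFun (funext fun t => ?_)
  rw [hchar, charFun_gaussianReal, W.norm_map]
  simp [mul_comm]

end Isonormal

/-! ### Cramér–Wold reduction, convergence and existence. -/

section SequentialEmpiricalProcess

open Topology

variable {U Ω : Type*} [MeasurableSpace U] {ν : Measure U}
  [IsProbabilityMeasure ν]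

lemma charFun_map_toLp [MeasurableSpace Ω] {K : ℕ} {P : Measure Ω} {V : Fin K → Ω → ℝ}
    (hV : ∀ j, AEMeasurable (V j) P) (t : EuclideanSpace ℝ (Fin K)) :
    charFun (P.map fun ω => WithLp.toLp 2 fun j => V j ω) t =
      charFun (P.map fun ω => ∑ j, t j * V j ω) 1 := by
  have h₁ : AEMeasurable (fun ω => ∑ j, t j * V j ω) P := by fun_prop
  have h₂ : AEMeasurable (fun ω => WithLp.toLp 2 fun j => V j ω) P := by fun_prop
  rw [charFun_apply, charFun_apply_real, integral_map h₁ (by fun_prop),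
    integral_map h₂ (by fun_prop)]
  simp [PiLp.inner_apply]

lemma isFiniteMeasure_discreteUniform {n : ℕ} (hn : n ≠ 0) :
    IsFiniteMeasure (discreteUniform n) := by
  refine ⟨?_⟩
  simp only [discreteUniform, Measure.smul_apply, Measure.finsetSum_apply, measure_univ]
  simp only [Finset.sum_const, Finset.card_univ, Fintype.card_fin, smul_eq_mul]
  exact ENNReal.mul_lt_top (by simp [hn, pos_iff_ne_zero]) (by simp)

lemma integral_discreteUniform (n : ℕ) (f : I → ℝ) :
    ∫ s, f s ∂(discreteUniform n) = (n : ℝ)⁻¹ * ∑ i : Fin n, f (gridPoint n i) := by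
  rw [discreteUniform, integral_smul_measure,
    integral_finsetSum_measure fun i _ => integrable_dirac (by simp)]
  simp

/-- `Z_n(q)` is the normalized sum of the centered summands. -/
lemma seqEmpiricalProcess_eq_sum (X : ℕ → Ω → U) (n : ℕ) (q : classQSubmodule ν) (ω : Ω) :
    seqEmpiricalProcess ν X n q.1 ω =
      ∑ i : Fin n, (√n)⁻¹ * centeredSection ν q (gridPoint n i, X i ω) := by
  rcases eq_or_ne n 0 with rfl | hn
  · simp [seqEmpiricalProcess]
  have := isFiniteMeasure_discreteUniform hn
  obtain ⟨g, hg, hqg⟩ := q.2.2.1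
  have hint : Integrable q.1 ((discreteUniform n).prod ν) :=
    ((hg.integrable (by norm_num)).comp_snd _).mono' q.2.1.aestronglyMeasurable
      (ae_of_all _ fun p => hqg p.1 p.2)
  have hs : √(n : ℝ) * (n : ℝ)⁻¹ = (√n)⁻¹ := by
    have : (√(n : ℝ)) ≠ 0 := by positivity
    nth_rewrite 2 [← Real.mul_self_sqrt (Nat.cast_nonneg n)]
    field_simp
  rw [seqEmpiricalProcess, seqEmpirical, integral_prod _ hint, integral_discreteUniform,
    ← mul_sub, ← mul_assoc, hs, ← Finset.sum_sub_distrib, Finset.mul_sum]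
  rfl

lemma seqEmpiricalProcess_sum_smul (X : ℕ → Ω → U) (n : ℕ) {K : ℕ}
    (q : Fin K → classQSubmodule ν) (t : Fin K → ℝ) (ω : Ω) :
    seqEmpiricalProcess ν X n (∑ j, t j • q j : classQSubmodule ν).1 ω =
      ∑ j, t j * seqEmpiricalProcess ν X n (q j).1 ω := by
  simp_rw [seqEmpiricalProcess_eq_sum, map_sum, map_smul, Finset.sum_apply, Pi.smul_apply,
    smul_eq_mul, Finset.mul_sum]
  rw [Finset.sum_comm]
  exact Finset.sum_congr rfl fun j _ => Finset.sum_congr rfl fun i _ => by ring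

variable [MeasurableSpace Ω]

lemma measurable_seqEmpiricalProcess {X : ℕ → Ω → U} (hX : ∀ i, Measurable (X i)) (n : ℕ)
    (q : classQSubmodule ν) : Measurable (seqEmpiricalProcess ν X n q.1) := by
  have h : seqEmpiricalProcess ν X n q.1 =
      fun ω => ∑ i : Fin n, (√n)⁻¹ * centeredSection ν q (gridPoint n i, X i ω) :=
    funext (seqEmpiricalProcess_eq_sum X n q)
  rw [h]
  exact Finset.measurable_fun_sum _ fun i _ => ((measurable_centeredSection q).comp
    (measurable_prodMk_left.comp (hX i))).const_mul _

lemma tendsto_charFun_seqEmpiricalProcess {P : Measure Ω} {X : ℕ → Ω → U}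
    (hX : ∀ i, Measurable (X i)) (hindep : iIndepFun X P) (hlaw : ∀ i, P.map (X i) = ν)
    (q : classQSubmodule ν) :
    Tendsto (fun n => charFun (P.map (seqEmpiricalProcess ν X n q.1)) 1) atTop
      (𝓝 (Complex.exp (-(kieferCov ν q.1 q.1 / 2 : ℝ)))) := by
  obtain ⟨G, hG, hqG⟩ := exists_memLp_bound_centeredSection q
  have h := tendsto_charFun_map_sum_triangular hX hindep hlaw hG
    (f := fun n i x => centeredSection ν q (gridPoint n i, x))
    (fun n i => (measurable_centeredSection q).comp measurable_prodMk_left)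
    (fun n i x => hqG _ x) (fun n i => integral_centeredSection q _)
    (tendsto_average_integral_sq_centeredSection q)
  refine h.congr fun n => ?_
  rw [funext (seqEmpiricalProcess_eq_sum X n q)]

lemma kieferCov_sum_smul {K : ℕ} (q : Fin K → classQSubmodule ν) (t : Fin K → ℝ) :
    kieferCov ν (∑ j, t j • q j : classQSubmodule ν).1 (∑ j, t j • q j : classQSubmodule ν).1 =
      ∑ i, ∑ j, t i * (t j * kieferCov ν (q i).1 (q j).1) := by
  simp_rw [← inner_centeredLp, map_sum, map_smul, sum_inner, inner_sum, real_inner_smul_left,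
    real_inner_smul_right]

lemma IsKieferProcess.charFun_map_sum {ν : Measure U} {P : Measure Ω} {Z : classQ ν → Ω → ℝ}
    (hZ : IsKieferProcess ν Z P) {K : ℕ} (q : Fin K → classQ ν) (t : Fin K → ℝ) :
    charFun (P.map fun ω => ∑ j, t j * Z (q j) ω) 1 =
      Complex.exp (-((∑ i, ∑ j, t i * (t j * kieferCov ν (q i).1 (q j).1)) / 2 : ℝ)) := by
  have := hZ.isGaussian.isProbabilityMeasure
  have hmem (j : Fin K) : MemLp (Z (q j)) 2 P := (hZ.isGaussian.hasGaussianLaw_eval _).memLp_two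
  have hg : HasGaussianLaw (fun ω => ∑ j, t j * Z (q j) ω) P :=
    ((hZ.isGaussian.comp_right q).smul t).hasGaussianLaw_fun_sum
  have hm : ∫ ω, ∑ j, t j * Z (q j) ω ∂P = 0 := by
    rw [integral_finsetSum _ fun j _ => ((hmem j).integrable (by norm_num)).const_mul _]
    simp [integral_const_mul, hZ.centered]
  have hv : Var[fun ω => ∑ j, t j * Z (q j) ω; P] =
      ∑ i, ∑ j, t i * (t j * kieferCov ν (q i).1 (q j).1) := by
    rw [← covariance_self hg.aemeasurable, covariance_fun_sum_fun_sum
      (fun j => (hmem j).const_mul (t j)) (fun j => (hmem j).const_mul (t j))]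
    simp_rw [covariance_const_mul_left, covariance_const_mul_right, hZ.cov_eq]
  -- Nonnegativity ensures that `Real.toNNReal` in the Gaussian law does not truncate the variance.
  have hv₀ := variance_nonneg (fun ω => ∑ j, t j * Z (q j) ω) P
  rw [hg.map_eq_gaussianReal, hm, hv, charFun_gaussianReal]
  rw [hv] at hv₀
  rw [Real.coe_toNNReal _ hv₀]
  simp

lemma tendstoInDistribution_seqEmpiricalProcess {P : Measure Ω} [IsProbabilityMeasure P]
    {X : ℕ → Ω → U} (hX : ∀ i, Measurable (X i)) (hindep : iIndepFun X P)
    (hlaw : ∀ i, P.map (X i) = ν) {Ω' : Type*} [MeasurableSpace Ω'] {P' : Measure Ω'}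
    [IsProbabilityMeasure P'] {Z : classQ ν → Ω' → ℝ} (hZ : IsKieferProcess ν Z P') {K : ℕ}
    (q : Fin K → classQ ν) :
    TendstoInDistribution
      (fun (n : ℕ) (ω : Ω) (j : Fin K) => seqEmpiricalProcess ν X n (q j) ω) atTop
      (fun (ω : Ω') (j : Fin K) => Z (q j) ω) (fun _ => P) P' := by
  have hXm (n : ℕ) (j : Fin K) : AEMeasurable (seqEmpiricalProcess ν X n (q j)) P :=
    (measurable_seqEmpiricalProcess hX n (⟨_, (q j).2⟩ : classQSubmodule ν)).aemeasurable
  have hZm (j : Fin K) : AEMeasurable (Z (q j)) P' := hZ.isGaussian.aemeasurable _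
  -- Lévy's continuity theorem needs an inner product, so it is applied in `EuclideanSpace`; the
  -- continuous map `WithLp.ofLp` then returns to `Fin K → ℝ`.
  have h : TendstoInDistribution (fun (n : ℕ) (ω : Ω) =>
      WithLp.toLp 2 fun j : Fin K => seqEmpiricalProcess ν X n (q j) ω) atTop
      (fun ω : Ω' => WithLp.toLp 2 fun j : Fin K => Z (q j) ω) (fun _ => P) P' := by
    refine ⟨fun n => by fun_prop, by fun_prop, ?_⟩
    refine ProbabilityMeasure.tendsto_of_tendsto_charFun fun t => ?_
    simp only [ProbabilityMeasure.coe_mk]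
    rw [charFun_map_toLp hZm, hZ.charFun_map_sum q t]
    have h₁ := tendsto_charFun_seqEmpiricalProcess hX hindep hlaw
      (∑ j, t j • (⟨_, (q j).2⟩ : classQSubmodule ν))
    rw [kieferCov_sum_smul] at h₁
    refine h₁.congr fun n => ?_
    rw [charFun_map_toLp (hXm n), funext (seqEmpiricalProcess_sum_smul X n _ t)]
  exact h.continuous_comp (g := WithLp.ofLp) (by fun_prop)

lemma exists_isKieferProcess (ν : Measure U) [IsProbabilityMeasure ν] :
    ∃ μ : Measure (classQ ν → ℝ), IsProbabilityMeasure μ ∧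
      IsKieferProcess ν (fun q z => z q) μ := by
  classical
  obtain ⟨ι, P, hP, W, hW⟩ := exists_isonormal (Lp ℝ 2 ((volume : Measure I).prod ν))
  let T : classQSubmodule ν →ₗ[ℝ] Lp ℝ 2 P := W.toLinearMap ∘ₗ centeredLp ν
  let Y (ω : ι → ℝ) (q : classQ ν) : ℝ := T ⟨q.1, q.2⟩ ω
  have hYq (q : classQ ν) : Measurable fun ω => Y ω q :=
    (Lp.stronglyMeasurable (T ⟨q.1, q.2⟩)).measurable
  have hY : Measurable Y := measurable_pi_lambda _ hYq
  have hmem (q : classQ ν) : MemLp (fun ω => Y ω q) 2 P := Lp.memLp _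
  have hlaw (q : classQSubmodule ν) :
      P.map (T q) = gaussianReal 0 (‖centeredLp ν q‖₊ ^ 2) := hW _
  have hmean (q : classQ ν) : ∫ ω, Y ω q ∂P = 0 := by
    have h : HasLaw (fun ω => Y ω q) (gaussianReal 0 (‖centeredLp ν ⟨q.1, q.2⟩‖₊ ^ 2)) P :=
      ⟨(hYq q).aemeasurable, hlaw ⟨q.1, q.2⟩⟩
    simpa using h.integral_eq
  have hμ : IsProbabilityMeasure (P.map Y) := Measure.isProbabilityMeasure_map hY.aemeasurable
  refine ⟨P.map Y, hμ, ⟨fun J => ⟨?_⟩⟩, fun q => ?_, fun q₁ q₂ => ?_⟩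
  · have hJ : Measurable fun (z : classQ ν → ℝ) => J.restrict fun q => z q := by fun_prop
    rw [Measure.map_map hJ hY]
    refine isGaussian_of_map_eq_gaussianReal fun L => ?_
    let c (q : J) : ℝ := L (Pi.single q 1)
    -- By linearity of `T`, the functional `L` of the finite vector is almost surely `T r`, whose
    -- law is a centered Gaussian.
    let r : classQSubmodule ν := ∑ q : J, c q • ⟨q.1.1, q.1.2⟩
    refine ⟨0, ‖centeredLp ν r‖₊ ^ 2, ?_⟩
    rw [Measure.map_map (by fun_prop) (hJ.comp hY), ← hlaw r]
    refine Measure.map_congr ?_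
    have hr : T r = ∑ q : J, c q • T ⟨q.1.1, q.1.2⟩ := by simp [r]
    -- Representatives in `L²` are linear only almost surely; finiteness of `J` leaves a single null
    -- set.
    have h₁ : ∀ᵐ ω ∂P, ∀ q : J, (c q • T ⟨q.1.1, q.1.2⟩ : Lp ℝ 2 P) ω = c q * Y ω q.1 :=
      ae_all_iff.2 fun q => Lp.coeFn_smul (c q) (T ⟨q.1.1, q.1.2⟩)
    rw [hr]
    filter_upwards [h₁, Lp.coeFn_finsetSum Finset.univ fun q : J => c q • T ⟨q.1.1, q.1.2⟩]
      with ω e₁ e₂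
    rw [e₂, Finset.sum_apply]
    simp_rw [e₁]
    change L (fun q : J => Y ω q.1) = _
    refine (LinearMap.pi_apply_eq_sum_univ L.toLinearMap _).trans ?_
    refine Finset.sum_congr rfl fun q _ => ?_
    have hc : (fun j : J => if q = j then (1 : ℝ) else 0) = Pi.single q 1 := by
      ext j
      simp [Pi.single_apply, eq_comm]
    rw [hc, smul_eq_mul, mul_comm]
    rfl
  · rw [integral_map hY.aemeasurable (measurable_pi_apply q).aestronglyMeasurable]
    exact hmean q
  · rw [covariance_map (measurable_pi_apply q₁).aestronglyMeasurable
      (measurable_pi_apply q₂).aestronglyMeasurable hY.aemeasurable]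
    have h := covariance_eq_sub (hmem q₁) (hmem q₂)
    rw [hmean, zero_mul, sub_zero] at h
    refine h.trans ?_
    have h₂ : inner ℝ (T ⟨q₁.1, q₁.2⟩) (T ⟨q₂.1, q₂.2⟩) = kieferCov ν q₁.1 q₂.1 :=
      (W.inner_map_map _ _).trans (inner_centeredLp _ _)
    rw [← h₂, L2.inner_def]
    exact integral_congr_ae (ae_of_all _ fun ω => mul_comm _ _)

end SequentialEmpiricalProcess

theorem proposition9 {U Ω : Type*} [MeasurableSpace U] [MeasurableSpace Ω]
    (ν : Measure U) [IsProbabilityMeasure ν] (P : Measure Ω) [IsProbabilityMeasure P]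
    (X : ℕ → Ω → U) (hX : ∀ i, Measurable (X i)) (hindep : iIndepFun X P)
    (hlaw : ∀ i, P.map (X i) = ν) :
    (∃ μ : Measure (classQ ν → ℝ), IsProbabilityMeasure μ ∧
      IsKieferProcess ν (fun q z => z q) μ) ∧
    ∀ {Ω' : Type*} [MeasurableSpace Ω'] (P' : Measure Ω') [IsProbabilityMeasure P']
      (Z : classQ ν → Ω' → ℝ), IsKieferProcess ν Z P' →
      ∀ (K : ℕ) (q : Fin K → classQ ν),
        TendstoInDistribution
          (fun (n : ℕ) (ω : Ω) (j : Fin K) => seqEmpiricalProcess ν X n (q j) ω) atTop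
          (fun (ω : Ω') (j : Fin K) => Z (q j) ω) (fun _ => P) P' :=
  ⟨exists_isKieferProcess ν, fun _ _ _ hZ _ q =>
    tendstoInDistribution_seqEmpiricalProcess hX hindep hlaw hZ q⟩
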